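/- Model. An input is an array $x_1,\dots,x_n$ of elements of a linearly ordered set, accessed only through comparisons "$x_i\le x_j$?". Its sorted order is by value, with equal values in input order. A *sorted subsequence* is a nonempty set of positions whose values are nondecreasing in input order and which forms a contiguous interval of the sorted order; it is *maximal* if it is not contained in a strictly larger one. *Stable partition sort* first tests whether the given array is sorted by comparing adjacent elements, and returns it if it is; otherwise it chooses a pivot $p$ from the array, splits the remaining elements into those before and those after $p$ in sorted order, keeping the input order within each part (one comparison per element), and recurses on the two parts. A pivot rule is *$(\beta,c)$-balanced* if on every array of $m\ge1$ distinct positions of every input it uses at most $cm$ comparisons and returns an element of the array such that at most $\beta m$ elements of the array precede it and at most $\beta m$ follow it in sorted order. Let $H(p_1,\dots,p_k)=-\sum_i p_i\log_2 p_i$. **Theorem.** 1. For all real $\beta<1$ and $c$ there is a constant $C>0$ such that stable partition sort with any $(\beta,c)$-balanced pivot rule sorts every input of every size $n$, and, whenever the positions of the input are partitioned into sorted subsequences of sizes $n_1,\dots,n_k$ (so $\sum_i n_i=n$), it uses at most $$C\sum_{i=1}^k n_i\log_2\!\Big(\frac n{n_i}+1\Big)\quad\text{and at most}\quad C\Big(n\,H\Big(\frac{n_1}n,\dots,\frac{n_k}n\Big)+n\Big)$$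 comparisons. The algorithm is not given the partition or the $n_i$. 2. A $(\tfrac12,c)$-balanced pivot rule exists for some constant $c$. Hence every input consisting of sorted subsequences of sizes $n_1,\dots,n_k$ can be sorted, without knowledge of the $n_i$, with $O\big(\sum_i n_i\log(n/n_i+1)\big)=O\big(n\,H(n_1/n,\dots,n_k/n)+n\big)$ comparisons. 3. The maximal sorted subsequences of any input partition its positions, so the bounds of part 1 hold in particular for their sizes. 4. The two bounds agree up to constant factors: there is $K>0$ such that for every $n$ and every partition of $n$ positions into nonempty sets of sizes $n_1,\dots,n_k$, each of $\sum_i n_i\log_2(n/n_i+1)$ and $n\,H(n_1/n,\dots,n_k/n)+n$ is at most $K$ times the other. -/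

import Mathlib

universe u


/-- Comparison programs (decision trees) over items `ι` with results in `β`. The program
`query i j k` asks whether the key of `i` is at most the key of `j` and continues with `k b`,
where `b` is the answer; this is its only access to the keys. -/
inductive CmpProg (ι β : Type) : Type where
  | done (b : β) : CmpProg ι β
  | query (i j : ι) (k : Bool → CmpProg ι β) : CmpProg ι β

namespace CmpProg

/-- Sequential composition. -/
def bind {ι β γ : Type} : CmpProg ι β → (β → CmpProg ι γ) → CmpProg ι γ
  | done b, f => f b
  | query i j k, f => query i j (fun b => (k b).bind f)

instance {ι : Type} : Monad (CmpProg ι) where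
  pure := done
  bind := bind

/-- The result of a program on the input in which the item `i` has key `x i`. -/
def eval {ι β : Type} {α : Type*} [LinearOrder α] (x : ι → α) : CmpProg ι β → β
  | done b => b
  | query i j k => (k (decide (x i ≤ x j))).eval x

/-- The number of comparisons made by a program on the input `x`. -/
def cost {ι β : Type} {α : Type*} [LinearOrder α] (x : ι → α) : CmpProg ι β → ℕ
  | done _ => 0
  | query i j k => (k (decide (x i ≤ x j))).cost x + 1

end CmpProg

/-- The sorted order of the positions of the input `x`: by key, equal keys in input order. -/
def Precedes {n : ℕ} {α : Type*} [LinearOrder α] (x : Fin n → α) (i j : Fin n) : Prop :=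
  x i < x j ∨ (x i = x j ∧ i < j)

instance {n : ℕ} {α : Type*} [LinearOrder α] (x : Fin n → α) (i j : Fin n) :
    Decidable (Precedes x i j) := by
  unfold Precedes; infer_instance

/-- A (nonempty) set `S` of positions is a sorted subsequence of `x` if the keys at the positions
in `S` are in nondecreasing order and `S` is a contiguous interval of the sorted order. -/
def IsSortedSubseq {n : ℕ} {α : Type*} [LinearOrder α] (x : Fin n → α)
    (S : Finset (Fin n)) : Prop :=
  S.Nonempty ∧
  (∀ i ∈ S, ∀ j ∈ S, i < j → x i ≤ x j) ∧
  (∀ i ∈ S, ∀ k ∈ S, ∀ j, Precedes x i j → Precedes x j k → j ∈ S)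

/-- Test whether an array is sorted by comparing adjacent elements. -/
def checkSorted {n : ℕ} : List (Fin n) → CmpProg (Fin n) Bool
  | [] => pure true
  | [_] => pure true
  | a :: b :: l => .query a b (fun t => if t then checkSorted (b :: l) else pure false)

/-- Decide, for `i ≠ j`, whether `i` precedes `j` in the sorted order, with one comparison. -/
def comparePos {n : ℕ} (i j : Fin n) : CmpProg (Fin n) Bool :=
  if i < j then .query i j (fun t => pure t) else .query j i (fun t => pure (!t))

/-- Stable partition around the pivot `p`: the elements other than `p` that precede `p` and those
that follow `p`, each in their original relative order. -/
def stablePartition {n : ℕ} (p : Fin n) :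
    List (Fin n) → CmpProg (Fin n) (List (Fin n) × List (Fin n))
  | [] => pure ([], [])
  | y :: l =>
    if y = p then stablePartition p l
    else do
      let t ← comparePos y p
      let r ← stablePartition p l
      pure (if t then (y :: r.1, r.2) else (r.1, y :: r.2))

/-- A pivot rule: `piv n a l` is a comparison program that chooses a pivot for the nonempty
array `a :: l` of positions of an input of size `n`. -/
abbrev PivotRule : Type := (n : ℕ) → Fin n → List (Fin n) → CmpProg (Fin n) (Fin n)

/-- Stable partition sort with early termination. The first argument bounds the recursion
depth; the length of the array always suffices, as each call removes the pivot. -/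
def partitionSortAux (piv : PivotRule) {n : ℕ} :
    ℕ → List (Fin n) → CmpProg (Fin n) (List (Fin n))
  | 0, A => pure A
  | _ + 1, [] => pure []
  | d + 1, a :: l => do
    let t ← checkSorted (a :: l)
    if t then pure (a :: l)
    else do
      let p ← piv n a l
      let r ← stablePartition p (a :: l)
      let lo ← partitionSortAux piv d r.1
      let hi ← partitionSortAux piv d r.2
      pure (lo ++ p :: hi)

/-- Stable partition sort of an input of size `n`; it returns the positions in sorted order. -/
def partitionSort (piv : PivotRule) (n : ℕ) : CmpProg (Fin n) (List (Fin n)) :=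
  partitionSortAux piv n (List.finRange n)

/-- On every array of `m` elements the rule uses at most `c * m` comparisons and returns an
element of the array such that at most `β * m` elements precede it and at most `β * m` follow it
in sorted order. -/
def IsBalancedPivotRule (piv : PivotRule) (β c : ℝ) : Prop :=
  ∀ (n : ℕ) (α : Type u) [LinearOrder α] (x : Fin n → α) (a : Fin n) (l : List (Fin n)),
    (a :: l).Nodup →
    let A := a :: l
    let p := (piv n a l).eval x
    p ∈ A ∧
    ((A.filter (fun y => decide (Precedes x y p))).length : ℝ) ≤ β * (A.length : ℝ) ∧
    ((A.filter (fun y => decide (Precedes x p y))).length : ℝ) ≤ β * (A.length : ℝ) ∧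
    ((piv n a l).cost x : ℝ) ≤ c * (A.length : ℝ)

/-- `∑ nᵢ log₂ (n / nᵢ + 1)`, where the `nᵢ` are the sizes of the parts of `P`. -/
noncomputable def sizeBound {n : ℕ} (P : Finpartition (Finset.univ : Finset (Fin n))) : ℝ :=
  ∑ S ∈ P.parts, (S.card : ℝ) * Real.logb 2 ((n : ℝ) / (S.card : ℝ) + 1)

/-- The binary entropy `H (n₁ / n, …, nₖ / n)`, where the `nᵢ` are the sizes of the parts. -/
noncomputable def sizeEntropy {n : ℕ} (P : Finpartition (Finset.univ : Finset (Fin n))) : ℝ :=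
  -∑ S ∈ P.parts, ((S.card : ℝ) / (n : ℝ)) * Real.logb 2 ((S.card : ℝ) / (n : ℝ))

/-! An unsorted array of length m in the recursion costs at most (c + 2)m comparisons: the
sortedness test, the pivot choice and the partition. The sorted arrays are disjoint leaves and cost
at most n in total. So it suffices to distribute the lengths of the unsorted arrays over the parts S
of the given partition: S is charged |S ∩ A| for every unsorted array A.

As long as pivots miss S, contiguity keeps S on one side of each pivot, so the arrays meeting S form
a single nested chain. The first pivot inside S splits S between two arrays, one with no outside
elements above S, the other with none below. In such an array every further pivot from S cuts off a
piece lying entirely in S; stability keeps that piece in input order, so it is sorted and is not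
charged. Hence only one charged chain continues on each side, and the weight of S is at most that of
two nested chains (`unsortedWeight_le_of_leans`, `unsortedWeight_le`).

Balance makes lengths along a chain shrink by the factor β, so the j-th array contributes at most
min(|S|, β^j n). Charging |S| for about log(n/|S|) arrays and summing the geometric tail gives O(|S|
log(n/|S| + 1)) (`exists_nestedBound_le`).

The balanced rule is median-of-medians selection (`select_spec`), and maximal sorted subsequences
are disjoint because overlapping ones can be merged (`IsSortedSubseq.union`). -/

section Programs

/-! ### Semantics of comparison programs. -/

variable {ι β γ : Type} {α : Type*} [LinearOrder α] (x : ι → α)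

@[simp] theorem CmpProg.eval_pure (b : β) : (pure b : CmpProg ι β).eval x = b := rfl

@[simp] theorem CmpProg.cost_pure (b : β) : (pure b : CmpProg ι β).cost x = 0 := rfl

@[simp] theorem CmpProg.eval_query (i j : ι) (k : Bool → CmpProg ι β) :
    (CmpProg.query i j k).eval x = (k (decide (x i ≤ x j))).eval x := rfl

@[simp] theorem CmpProg.cost_query (i j : ι) (k : Bool → CmpProg ι β) :
    (CmpProg.query i j k).cost x = (k (decide (x i ≤ x j))).cost x + 1 := rfl

@[simp] theorem CmpProg.eval_bind (m : CmpProg ι β) (f : β → CmpProg ι γ) :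
    (m >>= f).eval x = (f (m.eval x)).eval x := by
  change (m.bind f).eval x = _
  induction m with
  | done b => rfl
  | query i j k ih => exact ih _

@[simp] theorem CmpProg.cost_bind (m : CmpProg ι β) (f : β → CmpProg ι γ) :
    (m >>= f).cost x = m.cost x + (f (m.eval x)).cost x := by
  change (m.bind f).cost x = _
  induction m with
  | done b => simp [CmpProg.bind, CmpProg.cost, CmpProg.eval]
  | query i j k ih =>
    have := ih (decide (x i ≤ x j))
    simp only [CmpProg.bind, CmpProg.cost, CmpProg.eval]
    omega

end Programs

/-! ### The sorted order; results and costs of partitioning and of the sortedness test. -/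

section Order

variable {n : ℕ} {α : Type*} [LinearOrder α] {x : Fin n → α} {i j k : Fin n}

/-- Irreflexivity, transitivity and trichotomy are inherited from the lexicographic order on pairs
(key, position). -/
theorem precedes_iff_toLex :
    Precedes x i j ↔ toLex (x i, i) < toLex (x j, j) := by
  rw [Prod.Lex.toLex_lt_toLex]
  rfl

theorem not_precedes_self : ¬ Precedes x i i := by
  simp [precedes_iff_toLex]

theorem Precedes.trans (h : Precedes x i j) (h' : Precedes x j k) : Precedes x i k := by
  rw [precedes_iff_toLex] at *
  exact h.trans h'

theorem Precedes.asymm (h : Precedes x i j) : ¬ Precedes x j i :=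
  fun h' => not_precedes_self (h.trans h')

theorem Precedes.ne (h : Precedes x i j) : i ≠ j := by
  rintro rfl
  exact not_precedes_self h

theorem Precedes.le (h : Precedes x i j) : x i ≤ x j := by
  rcases h with h | h
  exacts [h.le, h.1.le]

theorem precedes_trichotomy (x : Fin n → α) (i j : Fin n) :
    Precedes x i j ∨ i = j ∨ Precedes x j i := by
  simp only [precedes_iff_toLex]
  rcases lt_trichotomy (toLex (x i, i)) (toLex (x j, j)) with h | h | h
  · exact .inl h
  · exact .inr (.inl (congrArg Prod.snd (toLex.injective h)))
  · exact .inr (.inr h)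

theorem precedes_of_lt_of_le (h : i < j) (hx : x i ≤ x j) : Precedes x i j :=
  hx.lt_or_eq.imp id fun e => ⟨e, h⟩

/-- Querying with the earlier position on the left makes a tie count in favour of input order, so
one comparison suffices. -/
theorem eval_comparePos (x : Fin n → α) (i j : Fin n) :
    (comparePos i j).eval x = decide (Precedes x i j) := by
  unfold comparePos Precedes
  split_ifs with hij
  · simp [hij, le_iff_lt_or_eq]
  · simp [hij, ← not_lt]

@[simp] theorem cost_comparePos (x : Fin n → α) : (comparePos i j).cost x = 1 := by
  unfold comparePos
  split_ifs <;> simp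

/-- The elements of `A` that precede `p`. -/
def lowerPart (x : Fin n → α) (p : Fin n) (A : List (Fin n)) : List (Fin n) :=
  A.filter fun y => decide (Precedes x y p)

/-- The elements of `A` that follow `p`. -/
def upperPart (x : Fin n → α) (p : Fin n) (A : List (Fin n)) : List (Fin n) :=
  A.filter fun y => decide (Precedes x p y)

@[simp] theorem mem_lowerPart {p y : Fin n} {A : List (Fin n)} :
    y ∈ lowerPart x p A ↔ y ∈ A ∧ Precedes x y p := by
  simp [lowerPart]

@[simp] theorem mem_upperPart {p y : Fin n} {A : List (Fin n)} :
    y ∈ upperPart x p A ↔ y ∈ A ∧ Precedes x p y := by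
  simp [upperPart]

theorem lowerPart_sublist (x : Fin n → α) (p : Fin n) (A : List (Fin n)) :
    (lowerPart x p A).Sublist A := List.filter_sublist

theorem upperPart_sublist (x : Fin n → α) (p : Fin n) (A : List (Fin n)) :
    (upperPart x p A).Sublist A := List.filter_sublist

theorem lowerPart_append_upperPart_perm {p : Fin n} {A : List (Fin n)} (hA : A.Nodup)
    (hp : p ∈ A) : (lowerPart x p A ++ p :: upperPart x p A).Perm A := by
  refine (List.perm_ext_iff_of_nodup ?_ hA).2 fun y => ?_
  · rw [List.nodup_append]
    refine ⟨hA.sublist (lowerPart_sublist x p A), List.nodup_cons.2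
      ⟨fun h => not_precedes_self (mem_upperPart.1 h).2,
        hA.sublist (upperPart_sublist x p A)⟩, ?_⟩
    rintro a ha b hb rfl
    have h := (mem_lowerPart.1 ha).2
    rcases List.mem_cons.1 hb with rfl | hb
    · exact not_precedes_self h
    · exact h.asymm (mem_upperPart.1 hb).2
  · simp only [List.mem_append, List.mem_cons, mem_lowerPart, mem_upperPart]
    constructor
    · rintro (h | rfl | h)
      exacts [h.1, hp, h.1]
    · intro h
      rcases precedes_trichotomy x y p with h' | h' | h'
      exacts [.inl ⟨h, h'⟩, .inr (.inl h'), .inr (.inr ⟨h, h'⟩)]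

theorem length_lowerPart_add_upperPart {p : Fin n} {A : List (Fin n)} (hA : A.Nodup)
    (hp : p ∈ A) : (lowerPart x p A).length + (upperPart x p A).length + 1 = A.length := by
  have := (lowerPart_append_upperPart_perm (x := x) hA hp).length_eq
  simp only [List.length_append, List.length_cons] at this
  omega

theorem eval_stablePartition (x : Fin n → α) (p : Fin n) (A : List (Fin n)) :
    (stablePartition p A).eval x = (lowerPart x p A, upperPart x p A) := by
  induction A with
  | nil => simp [stablePartition, lowerPart, upperPart]
  | cons y l ih =>
    unfold stablePartition
    split_ifs with h
    · subst h
      simp [ih, lowerPart, upperPart, not_precedes_self]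
    · rw [CmpProg.eval_bind, CmpProg.eval_bind, CmpProg.eval_pure, ih, eval_comparePos]
      rcases precedes_trichotomy x y p with h' | h' | h'
      · simp [h', lowerPart, upperPart, h'.asymm]
      · exact absurd h' h
      · simp [h', lowerPart, upperPart, h'.asymm]

theorem cost_stablePartition_le (x : Fin n → α) (p : Fin n) (A : List (Fin n)) :
    (stablePartition p A).cost x ≤ A.length := by
  induction A with
  | nil => simp [stablePartition]
  | cons y l ih =>
    unfold stablePartition
    split_ifs with h
    · simpa using ih.trans (Nat.le_succ _)
    · simp
      omega

theorem eval_checkSorted (x : Fin n → α) (A : List (Fin n)) :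
    (checkSorted A).eval x = true ↔ A.Pairwise fun i j => x i ≤ x j := by
  have : IsTrans (Fin n) fun i j => x i ≤ x j := ⟨fun _ _ _ => le_trans⟩
  rw [← List.isChain_iff_pairwise]
  induction A with
  | nil => simp [checkSorted]
  | cons a l ih =>
    cases l with
    | nil => simp [checkSorted]
    | cons b l =>
      rw [List.isChain_cons_cons, checkSorted, CmpProg.eval_query]
      by_cases h : x a ≤ x b <;> simp [h, ih]

theorem cost_checkSorted_le (x : Fin n → α) (A : List (Fin n)) :
    (checkSorted A).cost x ≤ A.length := by
  induction A with
  | nil => simp [checkSorted]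
  | cons a l ih =>
    cases l with
    | nil => simp [checkSorted]
    | cons b l =>
      rw [checkSorted, CmpProg.cost_query]
      by_cases h : x a ≤ x b
      · simpa [h] using ih
      · simp [h]

end Order

/-! ### Correctness, and charging comparisons to sorted subsequences. -/

section Sorting

variable {n : ℕ} {α : Type u} [LinearOrder α] {x : Fin n → α} {piv : PivotRule} {β c : ℝ}

/-- The pivot that the rule `piv` chooses on the array `a :: l` of the input `x`. -/
def pivotOf (piv : PivotRule) (x : Fin n → α) (a : Fin n) (l : List (Fin n)) : Fin n :=
  (piv n a l).eval x

theorem eval_partitionSortAux_succ (piv : PivotRule) (x : Fin n → α) (d : ℕ) (a : Fin n)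
    (l : List (Fin n)) :
    (partitionSortAux piv (d + 1) (a :: l)).eval x =
      if (checkSorted (a :: l)).eval x then a :: l
      else (partitionSortAux piv d (lowerPart x (pivotOf piv x a l) (a :: l))).eval x ++
        pivotOf piv x a l ::
          (partitionSortAux piv d (upperPart x (pivotOf piv x a l) (a :: l))).eval x := by
  rw [partitionSortAux, CmpProg.eval_bind]
  split_ifs with h
  · simp
  · simp [eval_stablePartition, pivotOf]

theorem cost_partitionSortAux_succ (piv : PivotRule) (x : Fin n → α) (d : ℕ) (a : Fin n)
    (l : List (Fin n)) :
    (partitionSortAux piv (d + 1) (a :: l)).cost x = (checkSorted (a :: l)).cost x +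
      if (checkSorted (a :: l)).eval x then 0
      else (piv n a l).cost x + (stablePartition (pivotOf piv x a l) (a :: l)).cost x +
        (partitionSortAux piv d (lowerPart x (pivotOf piv x a l) (a :: l))).cost x +
        (partitionSortAux piv d (upperPart x (pivotOf piv x a l) (a :: l))).cost x := by
  rw [partitionSortAux, CmpProg.cost_bind]
  split_ifs with h
  · simp
  · simp [eval_stablePartition, pivotOf]
    omega

theorem IsBalancedPivotRule.pivotOf_mem (hpiv : IsBalancedPivotRule.{u} piv β c)
    {a : Fin n} {l : List (Fin n)} (hA : (a :: l).Nodup) : pivotOf piv x a l ∈ a :: l :=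
  (hpiv n α x a l hA).1

theorem IsBalancedPivotRule.length_lowerPart_le (hpiv : IsBalancedPivotRule.{u} piv β c)
    {a : Fin n} {l : List (Fin n)} (hA : (a :: l).Nodup) :
    ((lowerPart x (pivotOf piv x a l) (a :: l)).length : ℝ) ≤ β * ((a :: l).length : ℝ) :=
  (hpiv n α x a l hA).2.1

theorem IsBalancedPivotRule.length_upperPart_le (hpiv : IsBalancedPivotRule.{u} piv β c)
    {a : Fin n} {l : List (Fin n)} (hA : (a :: l).Nodup) :
    ((upperPart x (pivotOf piv x a l) (a :: l)).length : ℝ) ≤ β * ((a :: l).length : ℝ) :=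
  (hpiv n α x a l hA).2.2.1

theorem IsBalancedPivotRule.cost_le (hpiv : IsBalancedPivotRule.{u} piv β c)
    {a : Fin n} {l : List (Fin n)} (hA : (a :: l).Nodup) :
    ((piv n a l).cost x : ℝ) ≤ c * ((a :: l).length : ℝ) :=
  (hpiv n α x a l hA).2.2.2

theorem IsBalancedPivotRule.mono {β' c' : ℝ} (hpiv : IsBalancedPivotRule.{u} piv β c)
    (hβ : β ≤ β') (hc : c ≤ c') : IsBalancedPivotRule.{u} piv β' c' := by
  intro n α _ x a l hA
  obtain ⟨h₁, h₂, h₃, h₄⟩ := hpiv n α x a l hA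
  exact ⟨h₁, h₂.trans (by gcongr), h₃.trans (by gcongr), h₄.trans (by gcongr)⟩

theorem partitionSortAux_correct (hpiv : IsBalancedPivotRule.{u} piv β c) (x : Fin n → α)
    (d : ℕ) (A : List (Fin n)) (hd : A.length ≤ d) (hA : A.Nodup) :
    ((partitionSortAux piv d A).eval x).Perm A ∧
      ((partitionSortAux piv d A).eval x).Pairwise fun i j => x i ≤ x j := by
  induction d generalizing A with
  | zero =>
    obtain rfl : A = [] := List.length_eq_zero_iff.1 (Nat.le_zero.1 hd)
    simp [partitionSortAux]
  | succ d ih =>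
    cases A with
    | nil => simp [partitionSortAux]
    | cons a l =>
      rw [eval_partitionSortAux_succ]
      split_ifs with h
      · exact ⟨.refl _, (eval_checkSorted x _).1 h⟩
      · have hp := hpiv.pivotOf_mem (x := x) hA
        have hlen := length_lowerPart_add_upperPart (x := x) hA hp
        have hlo := ih (lowerPart x (pivotOf piv x a l) (a :: l)) (by omega)
          (hA.sublist (lowerPart_sublist _ _ _))
        have hhi := ih (upperPart x (pivotOf piv x a l) (a :: l)) (by omega)
          (hA.sublist (upperPart_sublist _ _ _))
        refine ⟨(hlo.1.append (hhi.1.cons _)).trans (lowerPart_append_upperPart_perm hA hp), ?_⟩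
        have hlo' : ∀ y ∈ (partitionSortAux piv d
            (lowerPart x (pivotOf piv x a l) (a :: l))).eval x, x y ≤ x (pivotOf piv x a l) :=
          fun y hy => (mem_lowerPart.1 (hlo.1.mem_iff.1 hy)).2.le
        have hhi' : ∀ y ∈ (partitionSortAux piv d
            (upperPart x (pivotOf piv x a l) (a :: l))).eval x, x (pivotOf piv x a l) ≤ x y :=
          fun y hy => (mem_upperPart.1 (hhi.1.mem_iff.1 hy)).2.le
        rw [List.pairwise_append]
        refine ⟨hlo.2, List.pairwise_cons.2 ⟨hhi', hhi.2⟩, fun y hy z hz => ?_⟩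
        rcases List.mem_cons.1 hz with rfl | hz
        exacts [hlo' y hy, (hlo' y hy).trans (hhi' z hz)]

/-- The number of elements of `A` that lie in `S`. -/
def countIn (S : Finset (Fin n)) (A : List (Fin n)) : ℕ := (A.filter (· ∈ S)).length

theorem countIn_le_length (S : Finset (Fin n)) (A : List (Fin n)) : countIn S A ≤ A.length :=
  List.length_filter_le _ _

theorem countIn_le_card (S : Finset (Fin n)) {A : List (Fin n)} (hA : A.Nodup) :
    countIn S A ≤ S.card := by
  rw [countIn, ← List.toFinset_card_of_nodup (hA.filter _)]
  exact Finset.card_le_card fun y hy => by simpa using (List.mem_filter.1 (List.mem_toFinset.1 hy)).2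

theorem countIn_eq_zero {S : Finset (Fin n)} {A : List (Fin n)} (h : ∀ y ∈ A, y ∉ S) :
    countIn S A = 0 := by
  simpa [countIn] using h

theorem sum_countIn (P : Finpartition (Finset.univ : Finset (Fin n))) (A : List (Fin n)) :
    ∑ S ∈ P.parts, countIn S A = A.length := by
  induction A with
  | nil => simp [countIn]
  | cons a l ih =>
    have h : ∀ S ∈ P.parts, countIn S (a :: l) = (if S = P.part a then 1 else 0) + countIn S l := by
      intro S hS
      have : S = P.part a ↔ a ∈ S :=
        ⟨fun h => h ▸ P.mem_part (Finset.mem_univ a), fun h => (P.part_eq_of_mem hS h).symm⟩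
      by_cases ha : a ∈ S <;> simp [countIn, ha, this, add_comm]
    rw [Finset.sum_congr rfl h, Finset.sum_add_distrib, ih, Finset.sum_ite_eq',
      if_pos (P.part_mem.2 (Finset.mem_univ a))]
    simp [add_comm]

/-- The sum of the numbers of elements of `S` in the unsorted arrays of the recursion of
`partitionSortAux`. -/
def unsortedWeight (piv : PivotRule) (x : Fin n → α) (S : Finset (Fin n)) :
    ℕ → List (Fin n) → ℕ
  | 0, _ => 0
  | _ + 1, [] => 0
  | d + 1, a :: l =>
    if (checkSorted (a :: l)).eval x then 0
    else countIn S (a :: l) +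
      unsortedWeight piv x S d (lowerPart x (pivotOf piv x a l) (a :: l)) +
      unsortedWeight piv x S d (upperPart x (pivotOf piv x a l) (a :: l))

/-- Since P partitions the positions, an array's length is the sum of its intersections with the
parts, which pays for every unsorted array. The extra `A.length` pays for the sorted arrays, since
the two recursive calls act on disjoint subarrays. -/
theorem cost_partitionSortAux_le (hpiv : IsBalancedPivotRule.{u} piv β c)
    (x : Fin n → α) (P : Finpartition (Finset.univ : Finset (Fin n)))
    (d : ℕ) (A : List (Fin n)) (hA : A.Nodup) :
    ((partitionSortAux piv d A).cost x : ℝ) ≤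
      (c + 2) * ∑ S ∈ P.parts, (unsortedWeight piv x S d A : ℝ) + A.length := by
  induction d generalizing A with
  | zero => simp [partitionSortAux, unsortedWeight]
  | succ d ih =>
    cases A with
    | nil => simp [partitionSortAux, unsortedWeight]
    | cons a l =>
      have h₁ : ((checkSorted (a :: l)).cost x : ℝ) ≤ (a :: l).length := by
        exact_mod_cast cost_checkSorted_le x _
      rw [cost_partitionSortAux_succ]
      simp only [unsortedWeight]
      split_ifs with h
      · simpa using h₁
      · have h₂ : ((stablePartition (pivotOf piv x a l) (a :: l)).cost x : ℝ) ≤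
            (a :: l).length := by
          exact_mod_cast cost_stablePartition_le x _ _
        have h₃ := hpiv.cost_le (x := x) hA
        have h₄ : ∑ S ∈ P.parts, (countIn S (a :: l) : ℝ) = (a :: l).length := by
          exact_mod_cast sum_countIn P (a :: l)
        have h₅ : ((lowerPart x (pivotOf piv x a l) (a :: l)).length : ℝ) +
            (upperPart x (pivotOf piv x a l) (a :: l)).length + 1 = (a :: l).length := by
          exact_mod_cast length_lowerPart_add_upperPart hA (hpiv.pivotOf_mem hA)
        have hlo := ih _ (hA.sublist (lowerPart_sublist x (pivotOf piv x a l) _))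
        have hhi := ih _ (hA.sublist (upperPart_sublist x (pivotOf piv x a l) _))
        push_cast [Finset.sum_add_distrib, mul_add] at h₁ h₂ h₃ h₄ h₅ hlo hhi ⊢
        simp only [List.length_cons, Nat.cast_add, Nat.cast_one] at *
        rw [h₄]
        linarith

theorem IsSortedSubseq.mem_of_precedes {S : Finset (Fin n)} (hS : IsSortedSubseq x S)
    {i j k : Fin n} (hi : i ∈ S) (hk : k ∈ S) (hij : Precedes x i j) (hjk : Precedes x j k) :
    j ∈ S :=
  hS.2.2 i hi k hk j hij hjk

theorem unsortedWeight_eq_zero_of_disjoint {S : Finset (Fin n)} (d : ℕ) (A : List (Fin n))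
    (h : ∀ y ∈ A, y ∉ S) : unsortedWeight piv x S d A = 0 := by
  induction d generalizing A with
  | zero => simp [unsortedWeight]
  | succ d ih =>
    cases A with
    | nil => simp [unsortedWeight]
    | cons a l =>
      rw [unsortedWeight, countIn_eq_zero h, ih _ fun y hy => h y (mem_lowerPart.1 hy).1,
        ih _ fun y hy => h y (mem_upperPart.1 hy).1]
      simp

/-- This is where early termination and stability enter: the array is still in input order, so if it
lies inside S the test succeeds at once. -/
theorem unsortedWeight_eq_zero_of_subset {S : Finset (Fin n)} (hS : IsSortedSubseq x S) (d : ℕ)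
    {A : List (Fin n)} (hA : A.Pairwise (· < ·)) (h : ∀ y ∈ A, y ∈ S) :
    unsortedWeight piv x S d A = 0 := by
  cases d with
  | zero => simp [unsortedWeight]
  | succ d =>
    cases A with
    | nil => simp [unsortedWeight]
    | cons a l =>
      rw [unsortedWeight, if_pos]
      rw [eval_checkSorted]
      exact hA.imp_of_mem fun hi hj hij => hS.2.1 _ (h _ hi) _ (h _ hj) hij

/-- All elements of `A` outside `S` precede an element of `S`. -/
def LeansBelow (x : Fin n → α) (S : Finset (Fin n)) (A : List (Fin n)) : Prop :=
  ∀ y ∈ A, y ∉ S → ∃ s ∈ S, Precedes x y s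

/-- All elements of `A` outside `S` follow an element of `S`. -/
def LeansAbove (x : Fin n → α) (S : Finset (Fin n)) (A : List (Fin n)) : Prop :=
  ∀ y ∈ A, y ∉ S → ∃ s ∈ S, Precedes x s y

theorem LeansBelow.sublist {S : Finset (Fin n)} {A B : List (Fin n)} (h : LeansBelow x S A)
    (hB : B.Sublist A) : LeansBelow x S B := fun y hy => h y (hB.subset hy)

theorem LeansAbove.sublist {S : Finset (Fin n)} {A B : List (Fin n)} (h : LeansAbove x S A)
    (hB : B.Sublist A) : LeansAbove x S B := fun y hy => h y (hB.subset hy)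

theorem leansBelow_lowerPart {S : Finset (Fin n)} {p : Fin n} (hp : p ∈ S) (A : List (Fin n)) :
    LeansBelow x S (lowerPart x p A) := fun _ hy _ => ⟨p, hp, (mem_lowerPart.1 hy).2⟩

theorem leansAbove_upperPart {S : Finset (Fin n)} {p : Fin n} (hp : p ∈ S) (A : List (Fin n)) :
    LeansAbove x S (upperPart x p A) := fun _ hy _ => ⟨p, hp, (mem_upperPart.1 hy).2⟩

theorem IsSortedSubseq.subset_of_leans {S : Finset (Fin n)} (hS : IsSortedSubseq x S)
    {A : List (Fin n)} (h : LeansBelow x S A) (h' : LeansAbove x S A) : ∀ y ∈ A, y ∈ S := by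
  intro y hy
  by_contra hyS
  obtain ⟨s, hs, hys⟩ := h y hy hyS
  obtain ⟨t, ht, hty⟩ := h' y hy hyS
  exact hyS (hS.mem_of_precedes ht hs hty hys)

/-- A pivot with elements of S on both sides would itself belong to S by contiguity. -/
theorem IsSortedSubseq.disjoint_lowerPart_or_upperPart {S : Finset (Fin n)}
    (hS : IsSortedSubseq x S) {p : Fin n} (hp : p ∉ S) (A : List (Fin n)) :
    (∀ y ∈ lowerPart x p A, y ∉ S) ∨ ∀ y ∈ upperPart x p A, y ∉ S := by
  by_contra! h
  obtain ⟨⟨y, hy, hyS⟩, z, hz, hzS⟩ := h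
  exact hp (hS.mem_of_precedes hyS hzS (mem_lowerPart.1 hy).2 (mem_upperPart.1 hz).2)

/-- An upper bound for the total number of elements of a set of size `s` in a nested sequence of
arrays whose lengths shrink by the factor `β`, starting with an array of length `m`: the first `t`
arrays are charged `s` each, the others their lengths. -/
noncomputable def nestedBound (β s : ℝ) (t : ℕ) (m : ℝ) : ℝ := s * t + β ^ t * m / (1 - β)

theorem nestedBound_mono {β s : ℝ} (hβ : 0 ≤ β) (hβ' : β < 1) (t : ℕ) {m m' : ℝ} (h : m ≤ m') :
    nestedBound β s t m ≤ nestedBound β s t m' := by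
  have : 0 < 1 - β := by linarith
  unfold nestedBound
  gcongr

theorem nestedBound_nonneg {β s m : ℝ} (hβ : 0 ≤ β) (hβ' : β < 1) (hs : 0 ≤ s) (hm : 0 ≤ m)
    (t : ℕ) : 0 ≤ nestedBound β s t m := by
  have : 0 < 1 - β := by linarith
  unfold nestedBound
  positivity

/-- The recurrence for one array of the chain contributing e. If t > 0, one of the t charges of s
pays for e and t - 1 remain; if t = 0, the identity m/(1-β) = m + βm/(1-β) pays. -/
theorem exists_add_nestedBound_le {β s m e : ℝ} (hβ' : β < 1) (hs : e ≤ s)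
    (hm : e ≤ m) (t : ℕ) : ∃ t', e + nestedBound β s t' (β * m) ≤ nestedBound β s t m := by
  have h : 0 < 1 - β := by linarith
  cases t with
  | zero =>
    refine ⟨0, ?_⟩
    have : m / (1 - β) = m + β * m / (1 - β) := by field_simp; ring
    simp only [nestedBound, Nat.cast_zero, mul_zero, pow_zero, one_mul, zero_add]
    linarith
  | succ t =>
    refine ⟨t, ?_⟩
    unfold nestedBound
    rw [pow_succ, mul_assoc]
    push_cast
    linarith

/-- An array with outside elements on one side of S only never branches: at each pivot at least one
of the two subarrays has weight zero. -/
theorem unsortedWeight_le_of_leans (hpiv : IsBalancedPivotRule.{u} piv β c) (hβ : 0 ≤ β)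
    (hβ' : β < 1) {S : Finset (Fin n)} (hS : IsSortedSubseq x S) (d t : ℕ) (A : List (Fin n))
    (hA : A.Pairwise (· < ·)) (h : LeansBelow x S A ∨ LeansAbove x S A) :
    (unsortedWeight piv x S d A : ℝ) ≤ nestedBound β S.card t A.length := by
  induction d generalizing A t with
  | zero =>
    simpa [unsortedWeight] using nestedBound_nonneg hβ hβ' (by positivity) (by positivity) t
  | succ d ih =>
    have h0 := nestedBound_nonneg (s := S.card) (m := A.length) hβ hβ' (by positivity)
      (by positivity) t
    cases A with
    | nil => simpa [unsortedWeight] using h0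
    | cons a l =>
      rw [unsortedWeight]
      split_ifs with hsort
      · simpa using h0
      have hnd : (a :: l).Nodup := hA.imp ne_of_lt
      obtain ⟨t', ht'⟩ := exists_add_nestedBound_le (β := β) (s := S.card)
        (m := (a :: l).length) (e := countIn S (a :: l)) hβ'
        (by exact_mod_cast countIn_le_card S hnd) (by exact_mod_cast countIn_le_length S _) t
      have hp := hpiv.pivotOf_mem (x := x) hnd
      have hlo := nestedBound_mono (s := S.card) hβ hβ' t'
        (hpiv.length_lowerPart_le (x := x) hnd)
      have hhi := nestedBound_mono (s := S.card) hβ hβ' t'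
        (hpiv.length_upperPart_le (x := x) hnd)
      set p := pivotOf piv x a l
      have slo := lowerPart_sublist x p (a :: l)
      have shi := upperPart_sublist x p (a :: l)
      have ilo := ih t' (lowerPart x p (a :: l)) (hA.sublist slo)
        (h.imp (·.sublist slo) (·.sublist slo))
      have ihi := ih t' (upperPart x p (a :: l)) (hA.sublist shi)
        (h.imp (·.sublist shi) (·.sublist shi))
      suffices hz : unsortedWeight piv x S d (lowerPart x p (a :: l)) = 0 ∨
          unsortedWeight piv x S d (upperPart x p (a :: l)) = 0 by
        rcases hz with hz | hz <;> (rw [hz]; push_cast; linarith)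
      -- A pivot in S bounds the outside elements of each part from one side. On the part where the
      -- array's own leaning supplies the other side, nothing outside S is left.
      by_cases hpS : p ∈ S
      · rcases h with h | h
        · exact .inr (unsortedWeight_eq_zero_of_subset hS d (hA.sublist shi)
            (hS.subset_of_leans (h.sublist shi) (leansAbove_upperPart hpS _)))
        · exact .inl (unsortedWeight_eq_zero_of_subset hS d (hA.sublist slo)
            (hS.subset_of_leans (leansBelow_lowerPart hpS _) (h.sublist slo)))
      · exact (hS.disjoint_lowerPart_or_upperPart hpS (a :: l)).imp
          (unsortedWeight_eq_zero_of_disjoint d _) (unsortedWeight_eq_zero_of_disjoint d _)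

/-- The chain is single until a pivot falls in S and then becomes two leaning chains; that is the
factor 2. -/
theorem unsortedWeight_le (hpiv : IsBalancedPivotRule.{u} piv β c) (hβ : 0 ≤ β)
    (hβ' : β < 1) {S : Finset (Fin n)} (hS : IsSortedSubseq x S) (d t : ℕ) (A : List (Fin n))
    (hA : A.Pairwise (· < ·)) :
    (unsortedWeight piv x S d A : ℝ) ≤ 2 * nestedBound β S.card t A.length := by
  induction d generalizing A t with
  | zero =>
    simpa [unsortedWeight] using nestedBound_nonneg hβ hβ' (by positivity) (by positivity) t
  | succ d ih =>
    have h0 := nestedBound_nonneg (s := S.card) (m := A.length) hβ hβ' (by positivity)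
      (by positivity) t
    cases A with
    | nil => simpa [unsortedWeight] using h0
    | cons a l =>
      rw [unsortedWeight]
      split_ifs with hsort
      · simpa using h0
      have hnd : (a :: l).Nodup := hA.imp ne_of_lt
      obtain ⟨t', ht'⟩ := exists_add_nestedBound_le (β := β) (s := S.card)
        (m := (a :: l).length) (e := countIn S (a :: l)) hβ'
        (by exact_mod_cast countIn_le_card S hnd) (by exact_mod_cast countIn_le_length S _) t
      have hcount : (0 : ℝ) ≤ countIn S (a :: l) := by positivity
      have hp := hpiv.pivotOf_mem (x := x) hnd
      have hlo := nestedBound_mono (s := S.card) hβ hβ' t'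
        (hpiv.length_lowerPart_le (x := x) hnd)
      have hhi := nestedBound_mono (s := S.card) hβ hβ' t'
        (hpiv.length_upperPart_le (x := x) hnd)
      set p := pivotOf piv x a l
      have slo := lowerPart_sublist x p (a :: l)
      have shi := upperPart_sublist x p (a :: l)
      by_cases hpS : p ∈ S
      · have ilo := unsortedWeight_le_of_leans hpiv hβ hβ' hS d t' _ (hA.sublist slo)
          (.inl (leansBelow_lowerPart hpS _))
        have ihi := unsortedWeight_le_of_leans hpiv hβ hβ' hS d t' _ (hA.sublist shi)
          (.inr (leansAbove_upperPart hpS _))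
        push_cast
        linarith
      · have ilo := ih t' _ (hA.sublist slo)
        have ihi := ih t' _ (hA.sublist shi)
        rcases hS.disjoint_lowerPart_or_upperPart hpS (a :: l) with hz | hz <;>
          (rw [unsortedWeight_eq_zero_of_disjoint d _ hz]; push_cast; linarith)

end Sorting

/-! ### From nested chains to the size bound, and its comparison with entropy. -/

section Bounds

variable {n : ℕ} (P : Finpartition (Finset.univ : Finset (Fin n)))

variable {P} in
theorem one_le_card_div_card {S : Finset (Fin n)} (hS : S ∈ P.parts) :
    0 < (S.card : ℝ) ∧ 1 ≤ (n : ℝ) / S.card := by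
  have h : 0 < (S.card : ℝ) := by exact_mod_cast (P.nonempty_of_mem_parts hS).card_pos
  refine ⟨h, (one_le_div h).2 ?_⟩
  exact_mod_cast S.card_le_univ.trans_eq (Fintype.card_fin n)

variable {P} in
theorem one_le_logb_div_add_one {S : Finset (Fin n)} (hS : S ∈ P.parts) :
    1 ≤ Real.logb 2 ((n : ℝ) / S.card + 1) := by
  have := (one_le_card_div_card hS).2
  rw [Real.le_logb_iff_rpow_le one_lt_two (by linarith), Real.rpow_one]
  linarith

theorem sum_card_parts_cast : ∑ S ∈ P.parts, (S.card : ℝ) = n := by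
  exact_mod_cast P.sum_card_parts.trans (Finset.card_fin n)

theorem mul_sizeEntropy_add :
    (n : ℝ) * sizeEntropy P + n =
      ∑ S ∈ P.parts, (S.card : ℝ) * (Real.logb 2 ((n : ℝ) / S.card) + 1) := by
  simp only [mul_add, mul_one, Finset.sum_add_distrib, sum_card_parts_cast, sizeEntropy]
  rw [← Finset.sum_neg_distrib, Finset.mul_sum]
  congr 1
  refine Finset.sum_congr rfl fun S hS => ?_
  obtain ⟨h, h'⟩ := one_le_card_div_card hS
  have hn : (n : ℝ) ≠ 0 := by
    rintro hn
    rw [hn, zero_div] at h'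
    linarith
  rw [← inv_div, Real.logb_inv]
  field_simp

/-- Termwise, with r = n/|S| ≥ 1: r + 1 ≤ 2r. -/
theorem sizeBound_le : sizeBound P ≤ (n : ℝ) * sizeEntropy P + n := by
  rw [mul_sizeEntropy_add, sizeBound]
  refine Finset.sum_le_sum fun S hS => ?_
  obtain ⟨h, h'⟩ := one_le_card_div_card hS
  refine mul_le_mul_of_nonneg_left ?_ h.le
  calc Real.logb 2 ((n : ℝ) / S.card + 1) ≤ Real.logb 2 ((n : ℝ) / S.card * 2) :=
        Real.logb_le_logb_of_le one_lt_two (by linarith) (by linarith)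
    _ = _ := by
        rw [Real.logb_mul (by linarith) two_ne_zero, Real.logb_self_eq_one one_lt_two]

/-- Termwise, with r = n/|S| ≥ 1: both log₂ r and 1 are at most log₂(r + 1). -/
theorem le_two_mul_sizeBound : (n : ℝ) * sizeEntropy P + n ≤ 2 * sizeBound P := by
  rw [mul_sizeEntropy_add, sizeBound, Finset.mul_sum]
  refine Finset.sum_le_sum fun S hS => ?_
  obtain ⟨h, h'⟩ := one_le_card_div_card hS
  have h₁ := one_le_logb_div_add_one hS
  have h₂ : Real.logb 2 ((n : ℝ) / S.card) ≤ Real.logb 2 ((n : ℝ) / S.card + 1) :=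
    Real.logb_le_logb_of_le one_lt_two (by linarith) (by linarith)
  rw [mul_left_comm]
  refine mul_le_mul_of_nonneg_left ?_ h.le
  linarith

theorem cast_le_sizeBound : (n : ℝ) ≤ sizeBound P := by
  refine (sum_card_parts_cast P).symm.trans_le ?_
  refine Finset.sum_le_sum fun S hS => ?_
  exact le_mul_of_one_le_right (Nat.cast_nonneg _) (one_le_logb_div_add_one hS)

variable {P} in
theorem exists_nestedBound_le {b : ℝ} (hb : 0 < b) (hb' : b < 1) {S : Finset (Fin n)}
    (hS : S ∈ P.parts) : ∃ t, nestedBound b S.card t n ≤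
      ((-Real.logb 2 b)⁻¹ + 1 + (1 - b)⁻¹) *
        (S.card * Real.logb 2 ((n : ℝ) / S.card + 1)) := by
  obtain ⟨h, h'⟩ := one_le_card_div_card hS
  have h₁ := one_le_logb_div_add_one hS
  have h₂ : Real.logb 2 ((n : ℝ) / S.card) ≤ Real.logb 2 ((n : ℝ) / S.card + 1) :=
    Real.logb_le_logb_of_le one_lt_two (by linarith) (by linarith)
  have h₃ : 0 ≤ Real.logb 2 ((n : ℝ) / S.card) := Real.logb_nonneg one_lt_two h'
  have hL : 0 < -Real.logb 2 b := neg_pos.2 (Real.logb_neg one_lt_two hb hb')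
  have hb₁ : 0 < (1 - b)⁻¹ := inv_pos.2 (by linarith)
  set L := (-Real.logb 2 b)⁻¹ with hLdef
  have hLpos : 0 < L := inv_pos.2 hL
  set r := (n : ℝ) / S.card with hr
  -- The least t with b^t n ≤ |S|: from there on array lengths are a better bound than |S|, and the
  -- geometric tail is at most |S|/(1 - b).
  refine ⟨⌈L * Real.logb 2 r⌉₊, ?_⟩
  have ht := Nat.le_ceil (L * Real.logb 2 r)
  have ht' := (Nat.ceil_lt_add_one (mul_nonneg hLpos.le h₃)).le
  set t := ⌈L * Real.logb 2 r⌉₊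
  have hpow : b ^ t * n ≤ S.card := by
    have hn : (n : ℝ) = r * S.card := (div_mul_cancel₀ _ h.ne').symm
    have : b ^ t * r ≤ 1 := by
      have hr₀ : 0 < r := by linarith
      have hbt : 0 < b ^ t := pow_pos hb t
      rw [← Real.logb_nonpos_iff one_lt_two (mul_pos hbt hr₀), Real.logb_mul hbt.ne' hr₀.ne',
        Real.logb_pow]
      have : Real.logb 2 r ≤ t * -Real.logb 2 b := by
        rw [hLdef, inv_mul_le_iff₀ hL] at ht
        linarith
      linarith
    rw [hn, ← mul_assoc]
    exact mul_le_of_le_one_left h.le this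
  set ℓ := Real.logb 2 (r + 1)
  calc nestedBound b S.card t n = S.card * t + (1 - b)⁻¹ * (b ^ t * n) := by
        rw [nestedBound]; ring
    _ ≤ S.card * (L * ℓ + 1 * ℓ) + (1 - b)⁻¹ * (S.card * ℓ) := by
        refine add_le_add (mul_le_mul_of_nonneg_left (ht'.trans ?_) h.le)
          (mul_le_mul_of_nonneg_left (hpow.trans (le_mul_of_one_le_right h.le h₁)) hb₁.le)
        exact add_le_add (mul_le_mul_of_nonneg_left h₂ hLpos.le) (by linarith)
    _ = _ := by ring

theorem cost_partitionSort_le {α : Type u} [LinearOrder α] {x : Fin n → α} {piv : PivotRule}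
    {b c : ℝ} (hb : 0 < b) (hb' : b < 1) (hc : 0 ≤ c)
    (hpiv : IsBalancedPivotRule.{u} piv b c) (hP : ∀ S ∈ P.parts, IsSortedSubseq x S) :
    ((partitionSort piv n).cost x : ℝ) ≤
      ((c + 2) * (2 * ((-Real.logb 2 b)⁻¹ + 1 + (1 - b)⁻¹)) + 1) * sizeBound P := by
  have h := cost_partitionSortAux_le hpiv x P n (List.finRange n) (List.nodup_finRange n)
  rw [List.length_finRange] at h
  refine h.trans ?_
  rw [add_mul _ 1, one_mul, mul_assoc]
  refine add_le_add (mul_le_mul_of_nonneg_left ?_ (by linarith)) (cast_le_sizeBound P)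
  rw [sizeBound, Finset.mul_sum]
  refine Finset.sum_le_sum fun S hS => ?_
  obtain ⟨t, ht⟩ := exists_nestedBound_le hb hb' hS
  have := unsortedWeight_le hpiv hb.le hb' (hP S hS) n t (List.finRange n)
    (List.pairwise_lt_finRange n)
  rw [List.length_finRange] at this
  linarith

end Bounds

/-! ### Maximal sorted subsequences partition the positions. -/

section MaximalSubsequences

variable {n : ℕ} {α : Type*} [LinearOrder α] {x : Fin n → α}

theorem isSortedSubseq_singleton (x : Fin n → α) (i : Fin n) : IsSortedSubseq x {i} := by
  refine ⟨Finset.singleton_nonempty i, ?_, ?_⟩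
  · simp
  · simp only [Finset.mem_singleton]
    rintro _ rfl _ rfl j h h'
    exact absurd h' h.asymm

theorem IsSortedSubseq.lt_of_precedes {S : Finset (Fin n)} (hS : IsSortedSubseq x S)
    {i j : Fin n} (hi : i ∈ S) (hj : j ∈ S) (h : Precedes x i j) : i < j := by
  by_contra! hij
  exact h.asymm (precedes_of_lt_of_le (lt_of_le_of_ne hij h.ne.symm)
    (hS.2.1 j hj i hi (lt_of_le_of_ne hij h.ne.symm)))

/-- If x j < x i, then j precedes i. Unless e lies strictly between them in sorted order, i and j
both lie in S or both in T, or e is one of them, and sortedness of S or T is violated. If e lies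
between, T forces j < e and S forces e < i as positions, against i < j. -/
theorem IsSortedSubseq.le_of_mem_inter {S T : Finset (Fin n)} (hS : IsSortedSubseq x S)
    (hT : IsSortedSubseq x T) {e i j : Fin n} (heS : e ∈ S) (heT : e ∈ T) (hi : i ∈ S)
    (hj : j ∈ T) (hij : i < j) : x i ≤ x j := by
  by_contra! h
  have hji : Precedes x j i := .inl h
  rcases precedes_trichotomy x e j with hej | rfl | hje
  · exact h.not_ge (hS.2.1 i hi j (hS.mem_of_precedes heS hi hej hji) hij)
  · exact h.not_ge (hS.2.1 i hi e heS hij)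
  rcases precedes_trichotomy x e i with hei | rfl | hie
  · exact (((hT.lt_of_precedes hj heT hje).trans (hS.lt_of_precedes heS hi hei)).trans hij).false
  · exact h.not_ge (hT.2.1 e heT j hj hij)
  · exact h.not_ge (hT.2.1 i (hT.mem_of_precedes hj heT hji hie) j hj hij)

theorem IsSortedSubseq.mem_union_of_precedes {S T : Finset (Fin n)} (hS : IsSortedSubseq x S)
    (hT : IsSortedSubseq x T) {e i j k : Fin n} (heS : e ∈ S) (heT : e ∈ T) (hi : i ∈ S)
    (hk : k ∈ T) (hij : Precedes x i j) (hjk : Precedes x j k) : j ∈ S ∪ T := by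
  rw [Finset.mem_union]
  rcases precedes_trichotomy x e j with h | rfl | h
  exacts [.inr (hT.mem_of_precedes heT hk h hjk), .inl heS,
    .inl (hS.mem_of_precedes hi heS hij h)]

theorem IsSortedSubseq.union {S T : Finset (Fin n)} (hS : IsSortedSubseq x S)
    (hT : IsSortedSubseq x T) {e : Fin n} (heS : e ∈ S) (heT : e ∈ T) :
    IsSortedSubseq x (S ∪ T) := by
  refine ⟨⟨e, Finset.mem_union_left T heS⟩, fun i hi j hj hij => ?_,
    fun i hi k hk j hij hjk => ?_⟩
  · rcases Finset.mem_union.1 hi with hi | hi <;> rcases Finset.mem_union.1 hj with hj | hj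
    exacts [hS.2.1 i hi j hj hij, hS.le_of_mem_inter hT heS heT hi hj hij,
      hT.le_of_mem_inter hS heT heS hi hj hij, hT.2.1 i hi j hj hij]
  · rcases Finset.mem_union.1 hi with hi | hi <;> rcases Finset.mem_union.1 hk with hk | hk
    · exact Finset.mem_union_left T (hS.mem_of_precedes hi hk hij hjk)
    · exact hS.mem_union_of_precedes hT heS heT hi hk hij hjk
    · rw [Finset.union_comm]
      exact hT.mem_union_of_precedes hS heT heS hi hk hij hjk
    · exact Finset.mem_union_right S (hT.mem_of_precedes hi hk hij hjk)

/-- Singletons extend to maximal sorted subsequences by finiteness. Two maximal ones sharing a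
position both equal their union. -/
theorem exists_finpartition_maximal_isSortedSubseq (x : Fin n → α) :
    ∃ P : Finpartition (Finset.univ : Finset (Fin n)),
      ∀ S, S ∈ P.parts ↔ Maximal (IsSortedSubseq x) S := by
  classical
  refine ⟨Finpartition.ofExistsUnique
    (Finset.univ.filter fun S => Maximal (IsSortedSubseq x) S)
    (fun S _ => Finset.subset_univ S) (fun i _ => ?_) (fun h => ?_), fun S => ?_⟩
  · obtain ⟨S, hiS, hS⟩ := Finite.exists_le_maximal (isSortedSubseq_singleton x i)
    have hiS : i ∈ S := hiS (Finset.mem_singleton_self i)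
    refine ⟨S, ⟨by simpa using hS, hiS⟩, fun T hT => ?_⟩
    have hT' : Maximal (IsSortedSubseq x) T := by simpa using hT.1
    have hU := hS.prop.union hT'.prop hiS hT.2
    exact (hT'.eq_of_le hU Finset.subset_union_right).trans
      (hS.eq_of_le hU Finset.subset_union_left).symm
  · simpa using (Finset.mem_filter.1 h).2.prop.1
  · simp [Finpartition.ofExistsUnique]

end MaximalSubsequences

/-! ### Linear-cost median selection by median of medians. -/

section Selection

variable {n : ℕ}

/-- Insert `y` into a list in sorted order. -/
def insertPos (y : Fin n) : List (Fin n) → CmpProg (Fin n) (List (Fin n))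
  | [] => pure [y]
  | z :: l => do
    let t ← comparePos y z
    if t then pure (y :: z :: l)
    else do
      let r ← insertPos y l
      pure (z :: r)

/-- Insertion sort. -/
def insertionSort : List (Fin n) → CmpProg (Fin n) (List (Fin n))
  | [] => pure []
  | y :: l => do
    let r ← insertionSort l
    insertPos y r

/-- The medians of consecutive groups of five elements; up to four last elements are ignored. -/
def groupMedians : List (Fin n) → CmpProg (Fin n) (List (Fin n))
  | a :: b :: c :: d :: e :: l => do
    let s ← insertionSort [a, b, c, d, e]
    let r ← groupMedians l
    pure (s.getD 2 a :: r)
  | _ => pure []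

/-- Selection of the element of rank `k` by the median of medians. The first natural number bounds
the recursion depth, and `a` is a default value. -/
def select (a : Fin n) : ℕ → ℕ → List (Fin n) → CmpProg (Fin n) (Fin n)
  | 0, _, _ => pure a
  | d + 1, k, A =>
    if A.length < 24 then do
      let s ← insertionSort A
      pure (s.getD k a)
    else do
      let M ← groupMedians A
      let p ← select a d (M.length / 2) M
      let r ← stablePartition p A
      if k < r.1.length then select a d k r.1
      else if k = r.1.length then pure p
      else select a d (k - r.1.length - 1) r.2

variable {α : Type*} [LinearOrder α] (x : Fin n → α)

theorem insertPos_perm (y : Fin n) (l : List (Fin n)) :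
    ((insertPos y l).eval x).Perm (y :: l) := by
  induction l with
  | nil => simp [insertPos]
  | cons z l ih =>
    rw [insertPos, CmpProg.eval_bind]
    split_ifs
    · simp
    · simpa using (ih.cons z).trans (.swap y z l)

theorem insertPos_pairwise {y : Fin n} {l : List (Fin n)} (hy : y ∉ l)
    (hl : l.Pairwise (Precedes x)) : ((insertPos y l).eval x).Pairwise (Precedes x) := by
  induction l with
  | nil => simp [insertPos]
  | cons z l ih =>
    rw [List.mem_cons, not_or] at hy
    rw [insertPos, CmpProg.eval_bind, eval_comparePos]
    obtain ⟨hz, hl'⟩ := List.pairwise_cons.1 hl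
    split_ifs with h
    · rw [decide_eq_true_iff] at h
      refine List.pairwise_cons.2 ⟨fun w hw => ?_, hl⟩
      rcases List.mem_cons.1 hw with rfl | hw
      exacts [h, h.trans (hz w hw)]
    · rw [decide_eq_true_iff] at h
      rw [CmpProg.eval_bind, CmpProg.eval_pure]
      refine List.pairwise_cons.2 ⟨fun w hw => ?_, ih hy.2 hl'⟩
      rcases List.mem_cons.1 ((insertPos_perm x y l).mem_iff.1 hw) with rfl | hw
      · exact ((precedes_trichotomy x w z).resolve_left h).resolve_left hy.1
      · exact hz w hw

theorem cost_insertPos_le (y : Fin n) (l : List (Fin n)) :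
    (insertPos y l).cost x ≤ l.length := by
  induction l with
  | nil => simp [insertPos]
  | cons z l ih =>
    rw [insertPos, CmpProg.cost_bind]
    split_ifs
    · simp
    · simpa using by omega

theorem insertionSort_perm (l : List (Fin n)) : ((insertionSort l).eval x).Perm l := by
  induction l with
  | nil => simp [insertionSort]
  | cons y l ih =>
    rw [insertionSort, CmpProg.eval_bind]
    exact (insertPos_perm x y _).trans (ih.cons y)

theorem insertionSort_pairwise {l : List (Fin n)} (hl : l.Nodup) :
    ((insertionSort l).eval x).Pairwise (Precedes x) := by
  induction l with
  | nil => simp [insertionSort]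
  | cons y l ih =>
    rw [insertionSort, CmpProg.eval_bind]
    obtain ⟨hy, hl⟩ := List.nodup_cons.1 hl
    exact insertPos_pairwise x (fun h => hy ((insertionSort_perm x l).mem_iff.1 h)) (ih hl)

theorem cost_insertionSort_le (l : List (Fin n)) :
    (insertionSort l).cost x ≤ l.length * l.length := by
  induction l with
  | nil => simp [insertionSort]
  | cons y l ih =>
    rw [insertionSort, CmpProg.cost_bind]
    have h := cost_insertPos_le x y ((insertionSort l).eval x)
    rw [(insertionSort_perm x l).length_eq] at h
    rw [List.length_cons]
    nlinarith

theorem length_lowerPart_of_perm {A B : List (Fin n)} (h : A.Perm B) (p : Fin n) :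
    (lowerPart x p A).length = (lowerPart x p B).length :=
  (h.filter _).length_eq

theorem length_lowerPart_getElem {s : List (Fin n)} (hs : s.Pairwise (Precedes x)) {k : ℕ}
    (hk : k < s.length) : (lowerPart x s[k] s).length = k := by
  induction s generalizing k with
  | nil => simp at hk
  | cons b t ih =>
    obtain ⟨hb, ht⟩ := List.pairwise_cons.1 hs
    cases k with
    | zero =>
      simp only [List.getElem_cons_zero, List.length_eq_zero_iff, lowerPart, List.filter_eq_nil_iff,
        decide_eq_true_iff]
      intro y hy
      rcases List.mem_cons.1 hy with rfl | hy
      exacts [not_precedes_self, (hb y hy).asymm]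
    | succ k =>
      have hk' : k < t.length := by simpa using hk
      have := ih ht hk'
      simp only [lowerPart] at this
      simp [lowerPart, hb _ (List.getElem_mem hk'), this]

/-- The elements of a list that satisfy a monotone or antitone predicate are at least three times
as many as its group medians that do. -/
theorem groupMedians_spec (m : ℕ) (A : List (Fin n)) (hm : A.length ≤ m) (hA : A.Nodup) :
    ((groupMedians A).eval x).Subperm A ∧
      5 * ((groupMedians A).eval x).length ≤ A.length ∧
      A.length ≤ 5 * ((groupMedians A).eval x).length + 4 ∧
      (groupMedians A).cost x ≤ 25 * ((groupMedians A).eval x).length ∧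
      ∀ q : Fin n → Bool, ((∀ y z, Precedes x y z → q z → q y) ∨
          (∀ y z, Precedes x y z → q y → q z)) →
        3 * (((groupMedians A).eval x).filter q).length ≤ (A.filter q).length := by
  induction m generalizing A with
  | zero =>
    obtain rfl : A = [] := List.length_eq_zero_iff.1 (Nat.le_zero.1 hm)
    simp [groupMedians]
  | succ m ih =>
    match A, hm, hA with
    | a :: b :: c :: d :: e :: l, hm, hA =>
      have hl : [a, b, c, d, e].Nodup ∧ l.Nodup :=
        ⟨hA.sublist (List.sublist_append_left [a, b, c, d, e] l),
          hA.sublist (List.sublist_append_right [a, b, c, d, e] l)⟩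
      obtain ⟨ih₁, ih₂, ih₃, ih₄, ih₅⟩ := ih l (by simp at hm; omega) hl.2
      have hperm := insertionSort_perm x [a, b, c, d, e]
      have hpw := insertionSort_pairwise x hl.1
      have hcost := cost_insertionSort_le x [a, b, c, d, e]
      rw [groupMedians]
      simp only [CmpProg.eval_bind, CmpProg.cost_bind, CmpProg.eval_pure, CmpProg.cost_pure]
      generalize (insertionSort [a, b, c, d, e]).eval x = s at hperm hpw
      have hlen := hperm.length_eq
      match s, hlen, hperm, hpw with
      | [s₀, s₁, s₂, s₃, s₄], _, hperm, hpw =>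
        have hp : (s₀ :: s₁ :: s₂ :: s₃ :: s₄ :: l).Perm (a :: b :: c :: d :: e :: l) :=
          hperm.append_right l
        simp only [List.getD_cons_succ, List.getD_cons_zero, List.length_cons, List.length_nil]
          at hcost ⊢
        refine ⟨?_, by omega, by omega, by omega, fun q hq => ?_⟩
        · refine List.Subperm.trans ?_ hp.subperm
          have h₁ : (s₂ :: l).Sublist (s₀ :: s₁ :: s₂ :: s₃ :: s₄ :: l) :=
            .cons _ (.cons _ (.cons_cons _ (.cons _ (.cons _ (.refl l)))))
          exact ((List.subperm_cons s₂).2 ih₁).trans h₁.subperm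
        · rw [← (hp.filter q).length_eq]
          have := ih₅ q hq
          simp only [List.pairwise_cons, List.mem_cons, forall_eq_or_imp] at hpw
          obtain ⟨⟨h01, h02, -⟩, ⟨h12, -⟩, ⟨h23, h24, -⟩, -⟩ := hpw
          rw [← List.countP_eq_length_filter, ← List.countP_eq_length_filter] at this ⊢
          simp only [List.countP_cons]
          -- If the group median satisfies q, so do the two smaller or the two larger elements of
          -- its group, depending on the direction in which q is inherited.
          by_cases h2 : q s₂ = true
          · rcases hq with hq | hq
            · simp only [hq _ _ h02 h2, hq _ _ h12 h2, h2, if_true]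
              omega
            · simp only [hq _ _ h23 h2, hq _ _ h24 h2, h2, if_true]
              omega
          · simp only [h2, if_false, Bool.false_eq_true]
            omega
    | [], _, _ => simp [groupMedians]
    | [a], _, _ => simp [groupMedians]
    | [a, b], _, _ => simp [groupMedians]
    | [a, b, c], _, _ => simp [groupMedians]
    | [a, b, c, d], _, _ => simp [groupMedians]

theorem length_lowerPart_lowerPart {p q : Fin n} (h : Precedes x q p) (A : List (Fin n)) :
    (lowerPart x q (lowerPart x p A)).length = (lowerPart x q A).length := by
  simp only [lowerPart, List.filter_filter]
  congr 2
  funext y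
  rw [← Bool.decide_and, decide_eq_decide]
  exact ⟨And.left, fun hy => ⟨hy, hy.trans h⟩⟩

/-- Turns a rank within the upper part into a rank in A; it justifies the shift k - |lower part| - 1
in `select`. -/
theorem length_lowerPart_of_precedes {p q : Fin n} (h : Precedes x p q) {A : List (Fin n)}
    (hA : A.Nodup) (hp : p ∈ A) : (lowerPart x q A).length =
      (lowerPart x p A).length + 1 + (lowerPart x q (upperPart x p A)).length := by
  rw [← length_lowerPart_of_perm x (lowerPart_append_upperPart_perm (x := x) hA hp) q]
  have : lowerPart x q (lowerPart x p A) = lowerPart x p A :=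
    List.filter_eq_self.2 fun y hy => by simpa using (mem_lowerPart.1 hy).2.trans h
  unfold lowerPart at this ⊢
  rw [List.filter_append, this, List.filter_cons_of_pos (by simpa using h)]
  simp
  omega

theorem length_filter_not_add (q : Fin n → Bool) (A : List (Fin n)) :
    (A.filter q).length + (A.filter fun y => !q y).length = A.length := by
  simpa [← List.countP_eq_length_filter] using (List.length_eq_countP_add_countP q (l := A)).symm

/-- For m ≥ 24 elements and μ groups, 5μ ≤ m ≤ 5μ + 4, the group sorts cost at most 25μ ≤ 5m,
selecting the pivot at most 120μ ≤ 24m, and partitioning at most m. Either part has at most m - 3μ/2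
≤ 0.7m + 1.2 elements. The total is at most 114m + 144, which is at most 120m exactly when m ≥ 24.
Below 24, insertion sort costs at most m² ≤ 120m. -/
theorem select_spec (a : Fin n) (d k : ℕ) (A : List (Fin n)) (hd : A.length ≤ d) (hA : A.Nodup)
    (hk : k < A.length) :
    (select a d k A).eval x ∈ A ∧
      (lowerPart x ((select a d k A).eval x) A).length = k ∧
      (select a d k A).cost x ≤ 120 * A.length := by
  induction d generalizing k A with
  | zero => omega
  | succ d ih =>
    rw [select]
    split_ifs with hlen
    · have hperm := insertionSort_perm x A
      have hk' : k < ((insertionSort A).eval x).length := hperm.length_eq ▸ hk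
      have hcost := cost_insertionSort_le x A
      simp only [CmpProg.eval_bind, CmpProg.cost_bind, CmpProg.eval_pure, CmpProg.cost_pure,
        List.getD_eq_getElem _ _ hk']
      refine ⟨hperm.mem_iff.1 (List.getElem_mem hk'), ?_, by nlinarith⟩
      rw [← length_lowerPart_of_perm x hperm]
      exact length_lowerPart_getElem x (insertionSort_pairwise x hA) hk'
    · obtain ⟨hM, hM₁, hM₂, hMcost, hMq⟩ := groupMedians_spec x A.length A le_rfl hA
      simp only [CmpProg.eval_bind, CmpProg.cost_bind, eval_stablePartition]
      generalize (groupMedians A).eval x = M at *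
      have hMnd : M.Nodup := by
        obtain ⟨l, hl, hl'⟩ := hM
        exact hl.nodup_iff.1 (hA.sublist hl')
      obtain ⟨hpM, hrank, hpcost⟩ := ih (M.length / 2) M (by omega) hMnd (by omega)
      generalize (select a d (M.length / 2) M).eval x = p at *
      have hpA : p ∈ A := hM.subset hpM
      have hpart := cost_stablePartition_le x p A
      have hsumM := length_lowerPart_add_upperPart (x := x) hMnd hpM
      have hsum := length_lowerPart_add_upperPart (x := x) hA hpA
      -- At least half of the group medians do not precede p, and at least half do not follow it;
      -- each stands for three elements of A with the same property, which bounds both parts.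
      have hlo := hMq (fun y => !decide (Precedes x y p)) <| .inr fun y z hyz hy => by
        simp only [Bool.not_eq_true', decide_eq_false_iff_not] at hy ⊢
        exact fun hz => hy (hyz.trans hz)
      have hhi := hMq (fun y => !decide (Precedes x p y)) <| .inl fun y z hyz hz => by
        simp only [Bool.not_eq_true', decide_eq_false_iff_not] at hz ⊢
        exact fun hy => hz (hy.trans hyz)
      have eM₁ : (lowerPart x p M).length + _ = _ :=
        length_filter_not_add (fun y => decide (Precedes x y p)) M
      have eA₁ : (lowerPart x p A).length + _ = _ :=
        length_filter_not_add (fun y => decide (Precedes x y p)) A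
      have eM₂ : (upperPart x p M).length + _ = _ :=
        length_filter_not_add (fun y => decide (Precedes x p y)) M
      have eA₂ : (upperPart x p A).length + _ = _ :=
        length_filter_not_add (fun y => decide (Precedes x p y)) A
      split_ifs with h₁ h₂
      · obtain ⟨hq, hqrank, hqcost⟩ := ih k (lowerPart x p A) (by omega)
          (hA.sublist (lowerPart_sublist x p A)) h₁
        rw [mem_lowerPart] at hq
        rw [length_lowerPart_lowerPart x hq.2] at hqrank
        exact ⟨hq.1, hqrank, by omega⟩
      · simp only [CmpProg.eval_pure, CmpProg.cost_pure]
        exact ⟨hpA, h₂.symm, by omega⟩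
      · obtain ⟨hq, hqrank, hqcost⟩ := ih (k - (lowerPart x p A).length - 1) (upperPart x p A)
          (by omega) (hA.sublist (upperPart_sublist x p A)) (by omega)
        rw [mem_upperPart] at hq
        refine ⟨hq.1, ?_, by omega⟩
        rw [length_lowerPart_of_precedes x hq.2 hA hpA, hqrank]
        omega

/-- The pivot rule that selects the median. -/
def medianPivot : PivotRule := fun _ a l =>
  select a (a :: l).length ((a :: l).length / 2) (a :: l)

theorem isBalancedPivotRule_medianPivot : IsBalancedPivotRule.{u} medianPivot (1 / 2) 120 := by
  intro n α _ x a l hA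
  obtain ⟨hp, hrank, hcost⟩ := select_spec x a (a :: l).length ((a :: l).length / 2) (a :: l)
    le_rfl hA (Nat.div_lt_self (by simp) one_lt_two)
  have hsum := length_lowerPart_add_upperPart (x := x) hA hp
  refine ⟨hp, ?_, ?_, by exact_mod_cast hcost⟩
  · change ((lowerPart x _ (a :: l)).length : ℝ) ≤ _
    have : 2 * (lowerPart x ((medianPivot n a l).eval x) (a :: l)).length ≤ (a :: l).length := by
      unfold medianPivot
      omega
    have : (2 : ℝ) * (lowerPart x ((medianPivot n a l).eval x) (a :: l)).length ≤
      (a :: l).length := by exact_mod_cast this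
    linarith
  · change ((upperPart x _ (a :: l)).length : ℝ) ≤ _
    have : 2 * (upperPart x ((medianPivot n a l).eval x) (a :: l)).length ≤ (a :: l).length := by
      unfold medianPivot
      omega
    have : (2 : ℝ) * (upperPart x ((medianPivot n a l).eval x) (a :: l)).length ≤
      (a :: l).length := by exact_mod_cast this
    linarith

end Selection
-- Assembly of the four claims.
theorem mainTheorem1 :
    -- correctness and comparison bound for every linear-cost balanced pivot rule
    (∀ β c : ℝ, β < 1 → ∃ C : ℝ, 0 < C ∧
      ∀ piv : PivotRule, IsBalancedPivotRule.{u} piv β c →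
      ∀ (n : ℕ) (α : Type u) [LinearOrder α] (x : Fin n → α),
        ((partitionSort piv n).eval x).Perm (List.finRange n) ∧
        (((partitionSort piv n).eval x).map x).Pairwise (· ≤ ·) ∧
        ∀ P : Finpartition (Finset.univ : Finset (Fin n)),
          (∀ S ∈ P.parts, IsSortedSubseq x S) →
          ((partitionSort piv n).cost x : ℝ) ≤ C * sizeBound P ∧
          ((partitionSort piv n).cost x : ℝ) ≤ C * ((n : ℝ) * sizeEntropy P + n)) ∧
    -- a linear-cost rule that always returns the median exists
    (∃ (piv : PivotRule) (c : ℝ), IsBalancedPivotRule.{u} piv (1 / 2) c) ∧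
    -- the maximal sorted subsequences of an input partition it
    (∀ (n : ℕ) (α : Type u) [LinearOrder α] (x : Fin n → α),
      ∃ P : Finpartition (Finset.univ : Finset (Fin n)),
        ∀ S, S ∈ P.parts ↔ Maximal (IsSortedSubseq x) S) ∧
    -- the two bounds agree up to constant factors
    (∃ K : ℝ, 0 < K ∧ ∀ (n : ℕ) (P : Finpartition (Finset.univ : Finset (Fin n))),
      sizeBound P ≤ K * ((n : ℝ) * sizeEntropy P + n) ∧
      (n : ℝ) * sizeEntropy P + n ≤ K * sizeBound P) := by
  refine ⟨fun β c hβ => ?_, ⟨medianPivot, 120, isBalancedPivotRule_medianPivot⟩,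
    fun n α _ x => exists_finpartition_maximal_isSortedSubseq x,
    ⟨2, two_pos, fun n P => ⟨?_, le_two_mul_sizeBound P⟩⟩⟩
  -- Weakening β to at least 1/2 and c to at least 0 makes the logarithm of the shrinking factor
  -- finite and negative, and the constant positive, for arbitrary real β < 1 and c.
  · have hb : 0 < max β (1 / 2) := lt_max_of_lt_right (by norm_num)
    have hb' : max β (1 / 2) < 1 := max_lt hβ (by norm_num)
    have hc : 0 ≤ max c 0 := le_max_right _ _
    have hL : 0 < -Real.logb 2 (max β (1 / 2)) := neg_pos.2 (Real.logb_neg one_lt_two hb hb')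
    have hB : 0 < 1 - max β (1 / 2) := by linarith
    refine ⟨(max c 0 + 2) * (2 * ((-Real.logb 2 (max β (1 / 2)))⁻¹ + 1 +
      (1 - max β (1 / 2))⁻¹)) + 1, by positivity, fun piv hpiv n α _ x => ?_⟩
    have hpiv' := hpiv.mono (le_max_left β (1 / 2)) (le_max_left c 0)
    obtain ⟨hperm, hsorted⟩ := partitionSortAux_correct hpiv x n (List.finRange n)
      (by simp) (List.nodup_finRange n)
    refine ⟨hperm, List.pairwise_map.2 hsorted, fun P hP => ?_⟩
    have h := cost_partitionSort_le P hb hb' hc hpiv' hP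
    exact ⟨h, h.trans (mul_le_mul_of_nonneg_left (sizeBound_le P) (by positivity))⟩
  · have := sizeBound_le P
    have := (Nat.cast_nonneg n).trans (cast_le_sizeBound P)
    linarith
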